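/- **Theorem 4.** For $y\in\mathbb R^n$ let $s_c^-(y)$ be the maximum over $i\in\{1,\dots,n\}$ of the number of sign changes in the word $(y_i,\dots,y_n,y_1,\dots,y_i)$ after all its zero entries are deleted, and let $s_c^+(y)$ be the maximum, over $i$ and over all vectors $z$ obtained from $y$ by replacing each zero entry by $1$ or $-1$, of the number of sign changes in $(z_i,\dots,z_n,z_1,\dots,z_i)$. A system $\dot x(t)=A(t)x(t)$, with $A(\cdot)$ a continuous $n\times n$ real matrix function on an open interval $(a,b)$, is called a *cyclic variation diminishing differential system* on $(a,b)$ if its transition matrix $\Phi(t,t_0)$ (the solution of $\frac{d}{dt}\Phi=A(t)\Phi$ with $\Phi(t_0,t_0)=I$) satisfies $$s_c^+(\Phi(t,t_0)x)\le s_c^-(x)\quad\text{for all }x\in\mathbb R^n\setminus\{0\}\text{ and all }a<t_0<t<b.$$ Let $\mathbb Q^+\subset\mathbb R^{n\times n}$ be the set of matrices that are Metzler (all off-diagonal entries are nonnegative), irreducible (no simultaneous permutation of rows and columns brings the matrix to the form $\begin{bmatrix}B&C\\0&D\end{bmatrix}$ with a zero block of size $(n-r)\times r$, $1\le r\le n-1$),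 and can have nonzero entries only on the main diagonal, the super-diagonal, the sub-diagonal and in the positions $(1,n)$ and $(n,1)$. Fix a time interval $(a,b)$, $-\infty\le a<b\le\infty$, and let $A$ be a constant real $n\times n$ matrix. Then the system $\dot x=Ax$ is a cyclic variation diminishing differential system on $(a,b)$ if and only if $A\in\mathbb Q^+$. -/

import Mathlib

noncomputable section

namespace CyclicVDP

/-- The number `σ` of consecutive pairs of entries with negative product in a word of reals
(used below for words without zero entries). -/
def signChanges : List ℝ → ℕ
  | [] => 0
  | [_] => 0
  | u :: v :: w => (if u * v < 0 then 1 else 0) + signChanges (v :: w)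

/-- `s⁻`: the number of sign changes after all zero entries have been deleted. -/
def sMinus (w : List ℝ) : ℕ :=
  signChanges (w.filter fun u => u ≠ 0)

/-- The word `y_i, …, y_n, y_1, …, y_i` read once around the ring, starting and ending at `i`. -/
def cyclicWord {n : ℕ} (y : Fin n → ℝ) (i : Fin n) : List ℝ :=
  (List.ofFn y).rotate (i : ℕ) ++ [y i]

/-- The vector obtained from `y` by replacing every zero entry by `1` or `-1`, as prescribed
by `ε`. -/
def fillZeros {n : ℕ} (y : Fin n → ℝ) (ε : Fin n → Bool) : Fin n → ℝ :=
  fun i => if y i = 0 then (if ε i then 1 else -1) else y i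

/-- `s⁻_c`: the maximum over the starting points `i` of `s⁻ (y_i, …, y_n, y_1, …, y_i)`. -/
def sMinusCyc {n : ℕ} (y : Fin n → ℝ) : ℕ :=
  Finset.univ.sup fun i : Fin n => sMinus (cyclicWord y i)

/-- `s⁺_c`: the maximum over the starting points `i` and over all replacements of the zero entries
of `y` by `±1` of the number of sign changes around the ring. The first and last letters of a
cyclic word are the same entry of `y`, so they receive the same replacement. -/
def sPlusCyc {n : ℕ} (y : Fin n → ℝ) : ℕ :=
  Finset.univ.sup fun i : Fin n =>
    Finset.univ.sup fun ε : Fin n → Bool => signChanges (cyclicWord (fillZeros y ε) i)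

/-- The strong cyclic variation diminishing property of a square matrix. -/
def SCVDP {n : ℕ} (B : Matrix (Fin n) (Fin n) ℝ) : Prop :=
  ∀ x : Fin n → ℝ, x ≠ 0 → sPlusCyc (B.mulVec x) ≤ sMinusCyc x

/-- `Φ` is the transition matrix of `ẋ(t) = A(t) x(t)` on the open interval `(a, b)`, whose
endpoints may be infinite: for every `t₀` in `(a, b)`, the map `t ↦ Φ t t₀` solves
`dΦ/dt = A(t) Φ` on `(a, b)` with `Φ t₀ t₀ = I`. -/
structure IsTransitionMatrix {n : ℕ} (A : ℝ → Matrix (Fin n) (Fin n) ℝ) (a b : EReal)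
    (Φ : ℝ → ℝ → Matrix (Fin n) (Fin n) ℝ) : Prop where
  init : ∀ t₀ : ℝ, a < t₀ → t₀ < b → Φ t₀ t₀ = 1
  deriv : ∀ t₀ t : ℝ, a < t₀ → t₀ < b → a < t → t < b →
    HasDerivAt (fun s : ℝ => Φ s t₀) (A t * Φ t t₀) t

/-- The system `ẋ(t) = A(t) x(t)`, with `A` continuous, is a cyclic variation diminishing
differential system on `(a, b)`: its transition matrix (which exists and is unique on `(a, b)`)
satisfies `SCVDP (Φ t t₀)` whenever `a < t₀ < t < b`. -/
def IsCVDDS {n : ℕ} (A : ℝ → Matrix (Fin n) (Fin n) ℝ) (a b : EReal) : Prop :=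
  ∃ Φ : ℝ → ℝ → Matrix (Fin n) (Fin n) ℝ, IsTransitionMatrix A a b Φ ∧
    ∀ t₀ t : ℝ, a < t₀ → t₀ < t → t < b → SCVDP (Φ t t₀)

/-- Every off-diagonal entry is nonnegative. -/
def IsMetzler {n : ℕ} (A : Matrix (Fin n) (Fin n) ℝ) : Prop :=
  ∀ i j, i ≠ j → 0 ≤ A i j

/-- A simultaneous permutation of rows and columns brings `A` to the block form `[B C; 0 D]` with
a zero block of size `(n - r) × r`, `1 ≤ r ≤ n - 1`. Here `S` is the set of the `r` indices moved
to the front. -/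
def IsReducible {n : ℕ} (A : Matrix (Fin n) (Fin n) ℝ) : Prop :=
  ∃ S : Set (Fin n), S.Nonempty ∧ Sᶜ.Nonempty ∧ ∀ i ∈ Sᶜ, ∀ j ∈ S, A i j = 0

/-- The position `(i, j)` is on the main diagonal, the super-diagonal, the sub-diagonal, or is one
of the two corners `(1, n)`, `(n, 1)` (indices in `Fin n` start at `0`). -/
def InCyclicBand {n : ℕ} (i j : Fin n) : Prop :=
  i = j ∨ (i : ℕ) + 1 = j ∨ (j : ℕ) + 1 = i ∨
    ((i : ℕ) = 0 ∧ (j : ℕ) + 1 = n) ∨ ((i : ℕ) + 1 = n ∧ (j : ℕ) = 0)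

/-- The set `Q⁺` of `n × n` matrices that are Metzler, irreducible, and whose nonzero entries all
lie in the cyclic band. -/
def QPlus (n : ℕ) : Set (Matrix (Fin n) (Fin n) ℝ) :=
  {A | IsMetzler A ∧ ¬ IsReducible A ∧ ∀ i j, A i j ≠ 0 → InCyclicBand i j}

end CyclicVDP

end

/-!
For large `k` the flow `exp A` of a Metzler matrix `A` in the cyclic band is approximated by the
`k`-th power of `(1 + U / k) (1 + V / k)`, where `A = U + V`, `U` couples an entry to itself and to
its successor on the ring, and `V` to its predecessor. Each factor is nonnegative, so a nonzero
entry of the image has the sign of an entry of the argument at the same position or one step away,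
always on the same side; the resulting map of positions is monotone, hence an alternating cyclic
subword of the image pulls back to one of the argument (`HasCyclicChanges.of_map`). Having at least
`m` cyclic sign changes is an open condition, so it passes from `exp A x` to the approximations and
thence to `x` (`HasCyclicChanges.of_exp_mulVec`).

To replace `s⁻` by `s⁺` on the left, stop the solution `s ↦ exp (s A) x` at a time `τ < t` near which
every entry either vanishes identically or has no zero (`exists_isOpen_zero_or_ne`). An entry that
vanishes at `τ` then has zero velocity, and irreducibility makes such entries isolated, with
neighbours of opposite signs (`mul_neighbours_neg`); perturbing such a vector creates no sign change
(`eventually_hasCyclicChanges_imp`). Fill the zeros of `exp (t A) x` by small numbers so as to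
realize `s⁺`, and flow back to time `τ`: this gives a perturbation of `exp (τ A) x` with at least as
many sign changes, so `exp (τ A) x`, and therefore `x`, has that many too (`sCVDP_exp`).

Conversely, the variation diminishing property applied to the basis vectors makes the transition
matrix entrywise positive for small positive times; this gives the Metzler property by
differentiating, and irreducibility because the exponential of a reducible matrix keeps its zero
block. A positive `A i j` with `i` and `j` not neighbours would turn the vector with `1` at `j`, `0` at
`i` and `-δ` elsewhere, which has two sign changes, into one with four (`inCyclicBand_of_sCVDP`).
-/

namespace CyclicVDP

open Filter Topology Matrix

/-! ### Sign changes in words -/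

/-- Subadditivity of sign changes: inserting a nonzero letter after the first one of a word does not
lose any. -/
theorem signChanges_cons_le (u a : ℝ) (l : List ℝ) (ha : a ≠ 0) :
    signChanges (u :: l) ≤ (if u * a < 0 then 1 else 0) + signChanges (a :: l) := by
  cases l with
  | nil => simp [signChanges]
  | cons b l =>
    simp only [signChanges]
    by_cases h : u * b < 0
    · have : u * a < 0 ∨ a * b < 0 := by
        by_contra! hc
        have h1 : 0 ≤ (u * b) * (a * a) := by nlinarith [mul_nonneg hc.1 hc.2]
        have h2 : 0 < a * a := mul_self_pos.2 ha
        nlinarith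
      rcases this with h' | h' <;> simp only [h, h', if_true] <;> split_ifs <;> omega
    · simp only [h, if_false]; omega

/-- Deleting letters never creates sign changes in a word without zeros. -/
theorem signChanges_le_of_sublist {l w : List ℝ} (h : l.Sublist w) (hw : ∀ a ∈ w, a ≠ 0) :
    signChanges l ≤ signChanges w := by
  -- Induction needs a common first letter; afterwards it is taken to be `0`, which adds no
  -- sign change.
  have key : ∀ u : ℝ, signChanges (u :: l) ≤ signChanges (u :: w) := by
    induction h with
    | slnil => simp
    | @cons l w a h ih =>
      intro u
      have ih := ih (fun b hb => hw b (List.mem_cons_of_mem _ hb)) a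
      have := signChanges_cons_le u a l (hw a List.mem_cons_self)
      simp only [signChanges]
      omega
    | @cons_cons l w a h ih =>
      intro u
      have ih := ih (fun b hb => hw b (List.mem_cons_of_mem _ hb)) a
      simp only [signChanges]
      omega
  have h0 : ∀ l : List ℝ, signChanges (0 :: l) = signChanges l := by
    intro l; cases l <;> simp [signChanges]
  simpa [h0] using key 0

theorem signChanges_of_isChain {l : List ℝ} (h : l.IsChain fun u v => u * v < 0) :
    signChanges l = l.length - 1 := by
  induction l with
  | nil => rfl
  | cons u l ih =>
    cases l with
    | nil => rfl
    | cons v l =>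
      rw [List.isChain_cons_cons] at h
      simp [signChanges, h.1, ih h.2]
      omega

/-- A word without zeros contains an alternating subword witnessing all its sign changes. -/
theorem exists_alternating_sublist (u : ℝ) (w : List ℝ) (hw : ∀ a ∈ u :: w, a ≠ 0) :
    ∃ l : List ℝ, l.Sublist w ∧ (u :: l).IsChain (fun a b => a * b < 0) ∧
      l.length = signChanges (u :: w) := by
  induction w generalizing u with
  | nil => exact ⟨[], by simp [signChanges]⟩
  | cons v w ih =>
    obtain ⟨l, h1, h2, h3⟩ := ih v (fun b hb => hw b (List.mem_cons_of_mem _ hb))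
    by_cases h : u * v < 0
    · refine ⟨v :: l, h1.cons_cons v, ?_, ?_⟩
      · exact List.isChain_cons_cons.2 ⟨h, h2⟩
      · simp [signChanges, h, h3]; omega
    · refine ⟨l, h1.cons v, ?_, by simp [signChanges, h, h3]⟩
      have hu : u ≠ 0 := hw u (by simp)
      have hv : v ≠ 0 := hw v (by simp)
      have huv : 0 < u * v := lt_of_le_of_ne (not_lt.1 h) (Ne.symm (mul_ne_zero hu hv))
      cases l with
      | nil => simp
      | cons b l =>
        rw [List.isChain_cons_cons] at h2 ⊢
        refine ⟨?_, h2.2⟩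
        have h4 := mul_neg_of_pos_of_neg huv h2.1
        have h5 : 0 < v * v := mul_self_pos.2 hv
        by_contra! hc
        nlinarith [mul_nonneg hc h5.le]

theorem ne_zero_of_isChain_mul_neg {l : List ℝ} (h : l.IsChain fun u v => u * v < 0)
    (hl : 2 ≤ l.length) : ∀ a ∈ l, a ≠ 0 := by
  induction l with
  | nil => simp
  | cons u l ih =>
    cases l with
    | nil => simp at hl
    | cons v l =>
      rw [List.isChain_cons_cons] at h
      have hu : u ≠ 0 := by rintro rfl; simp at h
      have hv : v ≠ 0 := by rintro rfl; simp at h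
      cases l with
      | nil => simp [hu, hv]
      | cons c l =>
        intro a ha
        rcases List.mem_cons.1 ha with rfl | ha
        · exact hu
        · exact ih h.2 (by simp) a ha

theorem exists_alternating_of_sMinus_pos {w : List ℝ} (hw : 0 < sMinus w) :
    ∃ l : List ℝ, l.Sublist w ∧ l.IsChain (fun a b => a * b < 0) ∧ l.length = sMinus w + 1 := by
  unfold sMinus at hw ⊢
  have hne : ∀ a ∈ w.filter (fun u => u ≠ 0), a ≠ 0 := by
    intro a ha; simpa using (List.mem_filter.1 ha).2
  have hsub : (w.filter fun u => u ≠ 0).Sublist w := List.filter_sublist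
  revert hw hne hsub
  generalize w.filter (fun u => u ≠ 0) = v
  intro hw hne hsub
  cases v with
  | nil => simp [signChanges] at hw
  | cons u v =>
    obtain ⟨l, h1, h2, h3⟩ := exists_alternating_sublist u v hne
    exact ⟨u :: l, (h1.cons_cons u).trans hsub, h2, by simp [h3]⟩

theorem le_sMinus_of_alternating {w l : List ℝ} {m : ℕ} (hm : 0 < m) (hl : l.Sublist w)
    (hc : l.IsChain fun a b => a * b < 0) (hlen : l.length = m + 1) : m ≤ sMinus w := by
  have h0 := ne_zero_of_isChain_mul_neg hc (by omega)
  have h1 : l.Sublist (w.filter fun u => u ≠ 0) := by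
    have := hl.filter (fun u => decide (u ≠ 0))
    rwa [List.filter_eq_self.2 (by simpa using h0)] at this
  have h2 := signChanges_le_of_sublist h1 (by
    intro a ha; simpa using (List.mem_filter.1 ha).2)
  rw [signChanges_of_isChain hc, hlen] at h2
  simpa [sMinus] using h2

/-! ### Cyclic sign changes -/

/-- The position on the ring `Fin n` of an integer, i.e. its residue modulo `n`. -/
def ringIdx (n : ℕ) [NeZero n] (k : ℤ) : Fin n :=
  ⟨(k % n).toNat, by
    have hn : (0 : ℤ) < n := by exact_mod_cast Nat.pos_of_neZero n
    have h1 := Int.emod_nonneg k hn.ne'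
    have h2 := Int.emod_lt_of_pos k hn
    omega⟩

theorem fillZeros_ne_zero {n : ℕ} (y : Fin n → ℝ) (ε : Fin n → Bool) (i : Fin n) :
    fillZeros y ε i ≠ 0 := by
  unfold fillZeros
  split_ifs <;> simp_all

section Ring

variable {n : ℕ} [NeZero n]

theorem ringIdx_val (k : ℤ) : ((ringIdx n k : ℕ) : ℤ) = k % n := by
  have hn : (n : ℤ) ≠ 0 := by exact_mod_cast NeZero.ne n
  simp [ringIdx, Int.emod_nonneg k hn]

theorem ringIdx_eq_iff {k l : ℤ} : ringIdx n k = ringIdx n l ↔ k % n = l % n := by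
  rw [← ringIdx_val, ← ringIdx_val, Fin.ext_iff]
  norm_cast

@[simp]
theorem ringIdx_coe (i : Fin n) : ringIdx n (i : ℕ) = i := by
  apply Fin.ext
  zify
  rw [ringIdx_val]
  exact Int.emod_eq_of_lt (by omega) (by exact_mod_cast i.2)

@[simp]
theorem ringIdx_add_period (k : ℤ) : ringIdx n (k + n) = ringIdx n k := by
  rw [ringIdx_eq_iff]; simp

theorem ringIdx_add_congr {k l : ℤ} (h : ringIdx n k = ringIdx n l) (d : ℤ) :
    ringIdx n (k + d) = ringIdx n (l + d) := by
  rw [ringIdx_eq_iff] at h ⊢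
  exact Int.ModEq.add_right d h

/-- `x` has `m` cyclic sign changes: read around the ring, starting anywhere and travelling at
most once around, one meets `m + 1` entries of strictly alternating signs. Positions are integers,
and `x` is read `n`-periodically. -/
def HasCyclicChanges (m : ℕ) (x : Fin n → ℝ) : Prop :=
  ∃ j : ℕ → ℤ, (∀ l < m, j l < j (l + 1)) ∧ j m ≤ j 0 + n ∧
    ∀ l < m, x (ringIdx n (j l)) * x (ringIdx n (j (l + 1))) < 0

theorem cyclicWord_eq (x : Fin n → ℝ) (i : Fin n) :
    cyclicWord x i = List.ofFn fun k : Fin (n + 1) => x (ringIdx n (i + k)) := by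
  apply List.ext_getElem
  · simp [cyclicWord]
  · intro k h1 h2
    simp only [List.length_ofFn] at h2
    simp only [cyclicWord, List.getElem_ofFn]
    by_cases hk : k < n
    · rw [List.getElem_append_left (by simpa using hk), List.getElem_rotate, List.getElem_ofFn]
      congr 1
      apply Fin.ext
      zify
      rw [ringIdx_val]
      simp [add_comm]
    · have hk : k = n := by omega
      subst hk
      rw [List.getElem_append_right (by simp)]
      simp

theorem strictMono_steps {j : ℕ → ℤ} {m : ℕ} (hj : ∀ l < m, j l < j (l + 1)) {k l : ℕ}
    (hkl : k < l) (hl : l ≤ m) : j k < j l := by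
  induction l, hkl using Nat.le_induction with
  | base => exact hj k (by omega)
  | succ l h ih => exact (ih (by omega)).trans (hj l (by omega))

theorem hasCyclicChanges_sMinusCyc {x : Fin n → ℝ} (h : 0 < sMinusCyc x) :
    HasCyclicChanges (sMinusCyc x) x := by
  obtain ⟨i, -, hi⟩ := Finset.exists_mem_eq_sup (Finset.univ : Finset (Fin n))
    Finset.univ_nonempty (fun i => sMinus (cyclicWord x i))
  change sMinusCyc x = sMinus (cyclicWord x i) at hi
  rw [hi] at h ⊢
  obtain ⟨l, h1, h2, h3⟩ := exists_alternating_of_sMinus_pos h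
  generalize sMinus (cyclicWord x i) = m at *
  rw [cyclicWord_eq] at h1
  obtain ⟨f, hf⟩ := List.sublist_iff_exists_fin_orderEmbedding_get_eq.1 h1
  have hfl : ∀ k, (f k : ℕ) ≤ n := fun k => by
    have := (f k).2; simp only [List.length_ofFn] at this; omega
  have hget : ∀ k (hk : k < l.length), l[k] = x (ringIdx n (i + (f ⟨k, hk⟩ : ℕ))) := by
    intro k hk
    have := hf ⟨k, hk⟩
    simpa only [List.get_eq_getElem, List.getElem_ofFn] using this
  refine ⟨fun k => i + if hk : k < l.length then ((f ⟨k, hk⟩ : ℕ) : ℤ) else 0, ?_, ?_, ?_⟩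
  · intro k hk
    have a1 : k < l.length := by omega
    have a2 : k + 1 < l.length := by omega
    have : f ⟨k, a1⟩ < f ⟨k + 1, a2⟩ := f.strictMono (by simp)
    have : (f ⟨k, a1⟩ : ℕ) < f ⟨k + 1, a2⟩ := this
    simp only [a1, a2, dif_pos]
    omega
  · have a1 : m < l.length := by omega
    have a2 : 0 < l.length := by omega
    simp only [a1, a2, dif_pos]
    have := hfl ⟨m, a1⟩
    omega
  · intro k hk
    have a1 : k < l.length := by omega
    have a2 : k + 1 < l.length := by omega
    have := List.isChain_iff_getElem.1 h2 k a2
    rw [hget, hget] at this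
    simpa only [a1, a2, dif_pos] using this

theorem HasCyclicChanges.le_sMinusCyc {x : Fin n → ℝ} {m : ℕ} (hm : 0 < m)
    (h : HasCyclicChanges m x) : m ≤ sMinusCyc x := by
  obtain ⟨j, h1, h2, h3⟩ := h
  have hbd : ∀ k ≤ m, j 0 ≤ j k ∧ j k ≤ j 0 + n := by
    intro k hk
    constructor
    · rcases Nat.eq_zero_or_pos k with rfl | hk0
      · rfl
      · exact (strictMono_steps h1 hk0 hk).le
    · rcases hk.eq_or_lt with rfl | hk'
      · exact h2
      · exact (strictMono_steps h1 hk' le_rfl).le.trans h2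
  refine le_trans ?_ (Finset.le_sup (f := fun i => sMinus (cyclicWord x i))
    (Finset.mem_univ (ringIdx n (j 0))))
  refine le_sMinus_of_alternating (l := List.ofFn fun k : Fin (m + 1) => x (ringIdx n (j k))) hm
    ?_ ?_ (by simp)
  · rw [cyclicWord_eq]
    rw [List.sublist_iff_exists_fin_orderEmbedding_get_eq]
    refine ⟨OrderEmbedding.ofStrictMono
      (fun k => ⟨(j k - j 0).toNat, ?_⟩) ?_, ?_⟩
    · have hk := k.2
      simp only [List.length_ofFn] at hk ⊢
      have := hbd k (by omega)
      omega
    · intro k l hkl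
      have hl := l.2
      simp only [List.length_ofFn] at hl
      have := strictMono_steps h1 (show (k : ℕ) < l from hkl) (by omega)
      have := hbd k (by have : (k : ℕ) < l := hkl; omega)
      simp only [Fin.lt_def]
      omega
    · intro k
      have hk := k.2
      simp only [List.length_ofFn] at hk
      have := hbd k (by omega)
      simp only [List.get_eq_getElem, List.getElem_ofFn]
      congr 1
      rw [ringIdx_eq_iff]
      change j k % n = ((ringIdx n (j 0) : ℕ) + ((j k - j 0).toNat : ℤ)) % n
      rw [Int.toNat_of_nonneg (by omega), ringIdx_val]
      simp
  · rw [List.isChain_iff_getElem]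
    intro k hk
    simp only [List.length_ofFn] at hk
    simpa only [List.getElem_ofFn] using h3 k (by omega)

theorem sPlusCyc_eq (y : Fin n → ℝ) :
    sPlusCyc y = Finset.univ.sup fun ε : Fin n → Bool => sMinusCyc (fillZeros y ε) := by
  unfold sPlusCyc sMinusCyc
  rw [Finset.sup_comm]
  refine Finset.sup_congr rfl fun ε _ => Finset.sup_congr rfl fun i _ => ?_
  unfold sMinus
  rw [List.filter_eq_self.2]
  intro a ha
  rw [cyclicWord_eq, List.mem_ofFn] at ha
  obtain ⟨k, rfl⟩ := ha
  simpa using fillZeros_ne_zero y ε _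

theorem exists_hasCyclicChanges_fillZeros {y : Fin n → ℝ} (h : 0 < sPlusCyc y) :
    ∃ ε, HasCyclicChanges (sPlusCyc y) (fillZeros y ε) := by
  rw [sPlusCyc_eq] at h ⊢
  obtain ⟨ε, -, hε⟩ := Finset.exists_mem_eq_sup (Finset.univ : Finset (Fin n → Bool))
    Finset.univ_nonempty (fun ε => sMinusCyc (fillZeros y ε))
  rw [hε] at h ⊢
  exact ⟨ε, hasCyclicChanges_sMinusCyc h⟩

theorem HasCyclicChanges.le_sPlusCyc {y : Fin n → ℝ} {ε : Fin n → Bool} {m : ℕ} (hm : 0 < m)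
    (h : HasCyclicChanges m (fillZeros y ε)) : m ≤ sPlusCyc y := by
  rw [sPlusCyc_eq]
  exact (h.le_sMinusCyc hm).trans
    (Finset.le_sup (f := fun ε => sMinusCyc (fillZeros y ε)) (Finset.mem_univ ε))

/-- Sign changes are carried along by a monotone relabelling `φ` of positions, of degree one on the
ring, that preserves the signs of the nonzero entries. -/
theorem HasCyclicChanges.of_map {x y : Fin n → ℝ} {m : ℕ} (h : HasCyclicChanges m y) (φ : ℤ → ℤ)
    (hmono : Monotone φ) (hper : ∀ k, φ (k + n) = φ k + n)
    (hsign : ∀ k, y (ringIdx n k) ≠ 0 → 0 < x (ringIdx n (φ k)) * y (ringIdx n k)) :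
    HasCyclicChanges m x := by
  obtain ⟨j, h1, h2, h3⟩ := h
  have h4 : ∀ l < m, x (ringIdx n (φ (j l))) * x (ringIdx n (φ (j (l + 1)))) < 0 := by
    intro l hl
    have h5 := h3 l hl
    have a1 := hsign (j l) (by intro h; simp [h] at h5)
    have a2 := hsign (j (l + 1)) (by intro h; simp [h] at h5)
    by_contra! hc
    nlinarith [mul_pos a1 a2, mul_nonneg hc (neg_nonneg.2 h5.le)]
  refine ⟨fun l => φ (j l), fun l hl => ?_, (hmono h2).trans (hper _).le, h4⟩
  refine lt_of_le_of_ne (hmono (h1 l hl).le) fun heq => ?_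
  have := h4 l hl
  rw [← show φ (j l) = φ (j (l + 1)) from heq] at this
  nlinarith [mul_self_nonneg (x (ringIdx n (φ (j l))))]

theorem isOpen_hasCyclicChanges (m : ℕ) : IsOpen {x : Fin n → ℝ | HasCyclicChanges m x} := by
  have : {x : Fin n → ℝ | HasCyclicChanges m x} = ⋃ j : ℕ → ℤ,
      ⋃ (_ : (∀ l < m, j l < j (l + 1)) ∧ j m ≤ j 0 + n), ⋂ l ∈ Finset.range m,
        {x : Fin n → ℝ | x (ringIdx n (j l)) * x (ringIdx n (j (l + 1))) < 0} := by
    ext x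
    simp only [HasCyclicChanges, Set.mem_ofPred_eq, Set.mem_iUnion, Set.mem_iInter,
      Finset.mem_range, exists_prop, and_assoc]
  rw [this]
  refine isOpen_iUnion fun j => isOpen_iUnion fun _ => isOpen_biInter_finset fun l _ => ?_
  exact isOpen_lt (by fun_prop) continuous_const

end Ring

/-! ### A Lie product formula -/

section LieProduct

variable {𝔸 : Type*} [NormedRing 𝔸] [NormOneClass 𝔸]

theorem norm_pow_sub_pow_le {P Q : 𝔸} {M : ℝ} (hM : 1 ≤ M) (hP : ‖P‖ ≤ M) (hQ : ‖Q‖ ≤ M)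
    (k : ℕ) : ‖P ^ k - Q ^ k‖ ≤ k * M ^ k * ‖P - Q‖ := by
  induction k with
  | zero => simp
  | succ k ih =>
    have h1 : P ^ (k + 1) - Q ^ (k + 1) = P ^ k * (P - Q) + (P ^ k - Q ^ k) * Q := by
      rw [pow_succ, pow_succ]; noncomm_ring
    have h2 : ‖P ^ k‖ ≤ M ^ k := (norm_pow_le P k).trans (by gcongr)
    have hM0 : 0 ≤ M := by linarith
    calc ‖P ^ (k + 1) - Q ^ (k + 1)‖
        ≤ ‖P ^ k‖ * ‖P - Q‖ + ‖P ^ k - Q ^ k‖ * ‖Q‖ := by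
          rw [h1]
          exact (norm_add_le _ _).trans (add_le_add (norm_mul_le _ _) (norm_mul_le _ _))
      _ ≤ M ^ k * ‖P - Q‖ + (k * M ^ k * ‖P - Q‖) * M := by gcongr
      _ ≤ M ^ k * M * ‖P - Q‖ + (k * M ^ k * ‖P - Q‖) * M := by
          gcongr
          exact le_mul_of_one_le_right (by positivity) hM
      _ = ((k + 1 : ℕ) : ℝ) * M ^ (k + 1) * ‖P - Q‖ := by push_cast; ring

theorem tendsto_inv_nat : Tendsto (fun k : ℕ => ((k : ℝ))⁻¹) atTop (𝓝 0) :=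
  tendsto_inv_atTop_zero.comp tendsto_natCast_atTop_atTop

variable [NormedAlgebra ℝ 𝔸]

theorem eventually_norm_le_exp {F : ℝ → 𝔸} {A : 𝔸} (h0 : F 0 = 1) (hF : HasDerivAt F A 0) :
    ∀ᶠ h in 𝓝 (0 : ℝ), ‖F h‖ ≤ Real.exp ((‖A‖ + 1) * |h|) := by
  have h1 := (hasDerivAt_iff_isLittleO.1 hF).def (c := 1) one_pos
  filter_upwards [h1] with h hh
  simp only [sub_zero, h0, one_mul, Real.norm_eq_abs] at hh
  have h2 : F h = 1 + (h • A + (F h - 1 - h • A)) := by abel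
  calc ‖F h‖ ≤ ‖(1 : 𝔸)‖ + (‖h • A‖ + ‖F h - 1 - h • A‖) := by
        conv_lhs => rw [h2]
        exact (norm_add_le _ _).trans (add_le_add le_rfl (norm_add_le _ _))
    _ ≤ 1 + (|h| * ‖A‖ + |h|) := by
        rw [norm_one, norm_smul, Real.norm_eq_abs]; gcongr
    _ ≤ Real.exp ((‖A‖ + 1) * |h|) := by
        have := Real.add_one_le_exp ((‖A‖ + 1) * |h|); linarith

/-- Chernoff's form of the Lie product formula: any curve through `1` with velocity `A` there
approximates the exponential of `A` by powers. -/
theorem tendsto_pow_exp [CompleteSpace 𝔸] {F : ℝ → 𝔸} {A : 𝔸} (h0 : F 0 = 1)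
    (hF : HasDerivAt F A 0) :
    Tendsto (fun k : ℕ => F (k : ℝ)⁻¹ ^ k) atTop (𝓝 (NormedSpace.exp A)) := by
  set G : ℝ → 𝔸 := fun h => NormedSpace.exp (h • A) with hG
  have hG0 : G 0 = 1 := by simp [hG]
  have hGd : HasDerivAt G A 0 := by
    have := hasDerivAt_exp_smul_const (𝕂 := ℝ) A (0 : ℝ)
    simpa using this
  have hGk : ∀ k : ℕ, 0 < k → G (k : ℝ)⁻¹ ^ k = NormedSpace.exp A := by
    intro k hk
    let _ : NormedAlgebra ℚ 𝔸 := .restrictScalars ℚ ℝ 𝔸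
    have hk' : (k : ℝ) ≠ 0 := by positivity
    rw [hG, ← NormedSpace.exp_nsmul, ← Nat.cast_smul_eq_nsmul ℝ, smul_smul,
      mul_inv_cancel₀ hk', one_smul]
  set C := ‖A‖ + 1
  have hsmall : Tendsto (fun k : ℕ => (k : ℝ) * ‖F (k : ℝ)⁻¹ - G (k : ℝ)⁻¹‖) atTop (𝓝 0) := by
    have h1 : (fun h => F h - G h) =o[𝓝 0] fun h : ℝ => h := by
      have := (hasDerivAt_iff_isLittleO.1 (hF.sub hGd))
      simpa [h0, hG0] using this
    have h2 := (h1.comp_tendsto tendsto_inv_nat).norm_left.tendsto_div_nhds_zero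
    refine h2.congr fun k => ?_
    simp [div_eq_mul_inv, mul_comm]
  rw [tendsto_iff_norm_sub_tendsto_zero]
  refine squeeze_zero' (Eventually.of_forall fun _ => norm_nonneg _) ?_
    (by simpa using hsmall.const_mul (Real.exp C))
  filter_upwards [tendsto_inv_nat.eventually (eventually_norm_le_exp h0 hF),
    tendsto_inv_nat.eventually (eventually_norm_le_exp hG0 hGd), eventually_gt_atTop 0]
    with k h1 h2 hk
  rw [← hGk k hk]
  have hC : 0 ≤ C * |(k : ℝ)⁻¹| := by positivity
  refine (norm_pow_sub_pow_le (Real.one_le_exp hC) h1 h2 k).trans_eq ?_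
  have hk' : (k : ℝ) ≠ 0 := by positivity
  rw [← Real.exp_nat_mul, abs_of_nonneg (by positivity),
    show (k : ℝ) * (C * (k : ℝ)⁻¹) = C by field_simp]
  ring

end LieProduct

/-! ### The flow creates no sign changes -/

attribute [local instance] Matrix.linftyOpNormedRing Matrix.linftyOpNormedAlgebra

section Weak

/-- A nonzero entry of `B x` shares its sign with an entry of `x` that `B` feeds into it. -/
theorem exists_pos_of_mulVec {n : ℕ} {B : Matrix (Fin n) (Fin n) ℝ} (hB : ∀ i j, 0 ≤ B i j)
    {x : Fin n → ℝ} {i : Fin n} (hi : (B *ᵥ x) i ≠ 0) :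
    ∃ j, B i j ≠ 0 ∧ 0 < x j * (B *ᵥ x) i := by
  by_contra! hc
  have h1 : 0 < (B *ᵥ x) i * (B *ᵥ x) i := mul_self_pos.2 hi
  have h2 : (B *ᵥ x) i * (B *ᵥ x) i = ∑ j, B i j * (x j * (B *ᵥ x) i) := by
    conv_lhs => enter [1]; rw [Matrix.mulVec, dotProduct]
    rw [Finset.sum_mul]
    exact Finset.sum_congr rfl fun j _ => by ring
  have h3 : ∑ j, B i j * (x j * (B *ᵥ x) i) ≤ 0 := by
    refine Finset.sum_nonpos fun j _ => ?_
    by_cases h : B i j = 0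
    · simp [h]
    · exact mul_nonpos_of_nonneg_of_nonpos (hB i j) (hc j h)
  linarith

variable {n : ℕ} [NeZero n]

/-- A nonnegative matrix that couples each entry only to itself and to its neighbour on one fixed
side (`d = 1` for the successor, `d = -1` for the predecessor) creates no cyclic sign changes. -/
theorem HasCyclicChanges.of_mulVec {d : ℤ} (hd : -1 ≤ d) (hd' : d ≤ 1)
    {B : Matrix (Fin n) (Fin n) ℝ} (hB : ∀ i j, 0 ≤ B i j)
    (hsupp : ∀ i j, B i j ≠ 0 → j = i ∨ j = ringIdx n ((i : ℕ) + d)) {m : ℕ} {x : Fin n → ℝ}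
    (h : HasCyclicChanges m (B *ᵥ x)) : HasCyclicChanges m x := by
  classical
  refine h.of_map
    -- Stay in place if the sign is right there; otherwise the neighbour must have it.
    (fun k => if 0 < x (ringIdx n k) * (B *ᵥ x) (ringIdx n k) then k else k + d) ?_ ?_ ?_
  · refine monotone_int_of_le_succ fun k => ?_
    split_ifs <;> omega
  · intro k
    simp only [ringIdx_add_period]
    split_ifs <;> ring
  · intro k hk
    split_ifs with hpos
    · exact hpos
    · obtain ⟨j, h1, h2⟩ := exists_pos_of_mulVec hB hk
      rcases hsupp _ j h1 with rfl | rfl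
      · exact absurd h2 hpos
      · rwa [ringIdx_add_congr (ringIdx_coe (ringIdx n k))] at h2

theorem InCyclicBand.eq_or {i j : Fin n} (h : InCyclicBand i j) :
    j = i ∨ j = ringIdx n ((i : ℕ) + 1) ∨ j = ringIdx n ((i : ℕ) + -1) := by
  have hj := ringIdx_coe j
  rcases h with h | h | h | ⟨h1, h2⟩ | ⟨h1, h2⟩
  · exact Or.inl h.symm
  · right; left; rw [← hj]; congr 1; omega
  · right; right; rw [← hj]; congr 1; omega
  · right; right; rw [← ringIdx_add_period, ← hj]; congr 1; omega
  · right; left; rw [← hj, ← ringIdx_add_period]; congr 1; omega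

/-- The flow of a Metzler matrix in the cyclic band creates no cyclic sign changes: it is a limit
of products of nonnegative matrices each coupling an entry to a neighbour on one side only. -/
theorem HasCyclicChanges.of_exp_mulVec {A : Matrix (Fin n) (Fin n) ℝ} (hA : IsMetzler A)
    (hband : ∀ i j, A i j ≠ 0 → InCyclicBand i j) {m : ℕ} {x : Fin n → ℝ}
    (h : HasCyclicChanges m (NormedSpace.exp A *ᵥ x)) : HasCyclicChanges m x := by
  classical
  set U : Matrix (Fin n) (Fin n) ℝ :=
    Matrix.of fun i j => if j = i ∨ j = ringIdx n ((i : ℕ) + 1) then A i j else 0 with hU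
  set V : Matrix (Fin n) (Fin n) ℝ :=
    Matrix.of fun i j => if j = i ∨ j = ringIdx n ((i : ℕ) + 1) then 0 else A i j with hV
  have hUV : U + V = A := by
    ext i j
    simp only [hU, hV, Matrix.add_apply, Matrix.of_apply]
    split_ifs <;> simp
  set F : ℝ → Matrix (Fin n) (Fin n) ℝ := fun s => (1 + s • U) * (1 + s • V) with hF
  have hF0 : F 0 = 1 := by simp [hF]
  have hFd : HasDerivAt F A 0 := by
    have h1 : ∀ W : Matrix (Fin n) (Fin n) ℝ, HasDerivAt (fun s : ℝ => 1 + s • W) W 0 := by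
      intro W
      have := ((hasDerivAt_id (0 : ℝ)).smul_const W).const_add (1 : Matrix (Fin n) (Fin n) ℝ)
      rw [one_smul] at this
      exact this
    have := (h1 U).mul (h1 V)
    simp only [zero_smul, add_zero, one_mul, mul_one, hUV] at this
    exact this
  have hstep : ∀ᶠ s in 𝓝 (0 : ℝ), 0 ≤ s → ∀ v : Fin n → ℝ,
      HasCyclicChanges m (F s *ᵥ v) → HasCyclicChanges m v := by
    have hdiag : ∀ᶠ s in 𝓝 (0 : ℝ), ∀ i, 0 < 1 + s * A i i := by
      rw [Filter.eventually_all]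
      intro i
      have : ContinuousAt (fun s : ℝ => 1 + s * A i i) 0 := by fun_prop
      exact this.eventually_const_lt (by simp)
    filter_upwards [hdiag] with s hs hs0 v hv
    rw [hF, ← Matrix.mulVec_mulVec] at hv
    refine HasCyclicChanges.of_mulVec (d := -1) le_rfl (by norm_num) ?_ ?_
      (HasCyclicChanges.of_mulVec (d := 1) (by norm_num) le_rfl ?_ ?_ hv)
    · intro i j
      by_cases hij : i = j
      · subst hij; simp [hV]
      · have := mul_nonneg hs0 (hA i j hij)
        simp only [hV, Matrix.add_apply, Matrix.smul_apply, Matrix.of_apply, smul_eq_mul,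
          Matrix.one_apply_ne hij]
        split_ifs <;> simp [this]
    · intro i j hij
      by_contra! hc
      refine hij ?_
      simp only [hV, Matrix.add_apply, Matrix.smul_apply, Matrix.of_apply, smul_eq_mul,
        Matrix.one_apply_ne (Ne.symm hc.1)]
      split_ifs with h'
      · simp
      · have : A i j = 0 := by
          by_contra hne
          rcases (hband i j hne).eq_or with h'' | h'' | h''
          · exact hc.1 h''
          · exact h' (Or.inr h'')
          · exact hc.2 h''
        simp [this]
    · intro i j
      by_cases hij : i = j
      · subst hij; simpa [hU] using (hs i).le
      · have := mul_nonneg hs0 (hA i j hij)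
        simp only [hU, Matrix.add_apply, Matrix.smul_apply, Matrix.of_apply, smul_eq_mul,
          Matrix.one_apply_ne hij]
        split_ifs <;> simp [this]
    · intro i j hij
      by_contra! hc
      refine hij ?_
      simp [hU, hc.1, hc.2, Matrix.one_apply_ne (Ne.symm hc.1)]
  have hlim : Tendsto (fun k : ℕ => (F (k : ℝ)⁻¹ ^ k) *ᵥ x) atTop
      (𝓝 (NormedSpace.exp A *ᵥ x)) :=
    ((continuous_id.matrix_mulVec continuous_const).tendsto _).comp (tendsto_pow_exp hF0 hFd)
  have hev := hlim.eventually ((isOpen_hasCyclicChanges m).mem_nhds h)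
  obtain ⟨k, hk1, hk2⟩ := (hev.and (tendsto_inv_nat.eventually hstep)).exists
  have hk3 := hk2 (by positivity)
  have hpow : ∀ q : ℕ, ∀ v, HasCyclicChanges m ((F (k : ℝ)⁻¹ ^ q) *ᵥ v) →
      HasCyclicChanges m v := by
    intro q
    induction q with
    | zero => intro v hv; simpa using hv
    | succ q ih =>
      intro v hv
      rw [pow_succ, ← Matrix.mulVec_mulVec] at hv
      exact hk3 v (ih _ hv)
  exact hpow k x hk1

end Weak

/-! ### Linear flows -/

theorem exp_add_smul {n : ℕ} (A : Matrix (Fin n) (Fin n) ℝ) (s t : ℝ) :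
    NormedSpace.exp ((s + t) • A) = NormedSpace.exp (s • A) * NormedSpace.exp (t • A) := by
  rw [add_smul]
  exact Matrix.exp_add_of_commute _ _ (((Commute.refl A).smul_left s).smul_right t)

theorem exp_neg_smul_mul {n : ℕ} (A : Matrix (Fin n) (Fin n) ℝ) (s : ℝ) :
    NormedSpace.exp ((-s) • A) * NormedSpace.exp (s • A) = 1 := by
  rw [← exp_add_smul]; simp

theorem exp_mul_neg_smul {n : ℕ} (A : Matrix (Fin n) (Fin n) ℝ) (s : ℝ) :
    NormedSpace.exp (s • A) * NormedSpace.exp ((-s) • A) = 1 := by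
  rw [← exp_add_smul]; simp

theorem hasDerivAt_mulVec_apply {n : ℕ} {B : ℝ → Matrix (Fin n) (Fin n) ℝ}
    {A : Matrix (Fin n) (Fin n) ℝ} {t : ℝ} (hB : HasDerivAt B A t) (x : Fin n → ℝ) (i : Fin n) :
    HasDerivAt (fun s => (B s *ᵥ x) i) ((A *ᵥ x) i) t := by
  let ℓ : Matrix (Fin n) (Fin n) ℝ →ₗ[ℝ] ℝ :=
    { toFun := fun M => (M *ᵥ x) i
      map_add' := fun M N => by simp [Matrix.add_mulVec]
      map_smul' := fun c M => by simp [Matrix.smul_mulVec] }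
  exact (LinearMap.toContinuousLinearMap ℓ).hasFDerivAt.comp_hasDerivAt t hB

theorem hasDerivAt_exp_mulVec_apply {n : ℕ} (A : Matrix (Fin n) (Fin n) ℝ) (x : Fin n → ℝ)
    (i : Fin n) (s : ℝ) :
    HasDerivAt (fun s : ℝ => (NormedSpace.exp (s • A) *ᵥ x) i)
      ((A *ᵥ (NormedSpace.exp (s • A) *ᵥ x)) i) s := by
  rw [Matrix.mulVec_mulVec]
  exact hasDerivAt_mulVec_apply (hasDerivAt_exp_smul_const' (𝕂 := ℝ) A s) x i

/-- Uniqueness of the transition matrix: `exp (-(s - t) A) (B s)` is constant. -/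
theorem eq_exp_of_hasDerivAt {n : ℕ} {B : ℝ → Matrix (Fin n) (Fin n) ℝ}
    {A : Matrix (Fin n) (Fin n) ℝ}
    {t u : ℝ} (htu : t ≤ u) (h0 : B t = 1) (hB : ∀ s ∈ Set.Icc t u, HasDerivAt B (A * B s) s) :
    B u = NormedSpace.exp ((u - t) • A) := by
  have hE : ∀ s : ℝ, HasDerivAt (fun s : ℝ => NormedSpace.exp ((-(s - t)) • A))
      (-(NormedSpace.exp ((-(s - t)) • A) * A)) s := by
    intro s
    have h1 := hasDerivAt_exp_smul_const (𝕂 := ℝ) A (-(s - t))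
    have h2 : HasDerivAt (fun s : ℝ => -(s - t)) (-1) s := ((hasDerivAt_id s).sub_const t).neg
    have h3 := h1.scomp s h2
    rw [neg_one_smul] at h3
    exact h3
  have hG : ∀ s ∈ Set.Icc t u,
      HasDerivAt (fun s => NormedSpace.exp ((-(s - t)) • A) * B s) 0 s := by
    intro s hs
    have := (hE s).mul (hB s hs)
    simp only [neg_mul, mul_assoc, neg_add_cancel] at this
    exact this
  have hconst := constant_of_has_deriv_right_zero
    (fun s hs => (hG s hs).continuousAt.continuousWithinAt)
    (fun s hs => (hG s ⟨hs.1, hs.2.le⟩).hasDerivWithinAt) u ⟨htu, le_rfl⟩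
  simp only [sub_self, neg_zero, zero_smul, NormedSpace.exp_zero, h0, one_mul] at hconst
  have := congrArg (fun M => NormedSpace.exp ((u - t) • A) * M) hconst
  simpa only [← mul_assoc, exp_mul_neg_smul, one_mul, mul_one] using this

/-- Finitely many continuous functions admit a common nonempty open set on which each of them
either vanishes identically or has no zero. -/
theorem exists_isOpen_zero_or_ne {ι : Type*} [Finite ι] {f : ι → ℝ → ℝ}
    (hf : ∀ i, Continuous (f i)) {U : Set ℝ} (hU : IsOpen U) (hne : U.Nonempty) :
    ∃ V ⊆ U, IsOpen V ∧ V.Nonempty ∧ ∀ i, (∀ s ∈ V, f i s = 0) ∨ ∀ s ∈ V, f i s ≠ 0 := by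
  classical
  cases nonempty_fintype ι
  suffices h : ∀ I : Finset ι, ∃ V ⊆ U, IsOpen V ∧ V.Nonempty ∧
      ∀ i ∈ I, (∀ s ∈ V, f i s = 0) ∨ ∀ s ∈ V, f i s ≠ 0 by
    simpa using h Finset.univ
  intro I
  induction I using Finset.induction_on with
  | empty => exact ⟨U, subset_rfl, hU, hne, by simp⟩
  | insert i I _ ih =>
    obtain ⟨V, hVU, hV, hVne, hVI⟩ := ih
    by_cases h : ∀ s ∈ V, f i s = 0
    · refine ⟨V, hVU, hV, hVne, fun k hk => ?_⟩
      rcases Finset.mem_insert.1 hk with rfl | hk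
      · exact Or.inl h
      · exact hVI k hk
    · push Not at h
      obtain ⟨s, hsV, hs⟩ := h
      refine ⟨V ∩ f i ⁻¹' {0}ᶜ, Set.inter_subset_left.trans hVU,
        hV.inter (isOpen_compl_singleton.preimage (hf i)), ⟨s, hsV, hs⟩, fun k hk => ?_⟩
      rcases Finset.mem_insert.1 hk with rfl | hk
      · exact Or.inr fun s hs => hs.2
      · exact (hVI k hk).imp (fun h s hs => h s hs.1) (fun h s hs => h s hs.1)

/-! ### The strong property for matrices in `Q⁺` -/

section Strong

variable {n : ℕ} [NeZero n]

/-- In a vector all of whose zeros are isolated and separate entries of opposite signs, no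
small perturbation creates sign changes. -/
theorem eventually_hasCyclicChanges_imp {w : Fin n → ℝ}
    (hw : ∀ k, w (ringIdx n k) = 0 → w (ringIdx n (k + -1)) * w (ringIdx n (k + 1)) < 0) (m : ℕ) :
    ∀ᶠ v in 𝓝 w, HasCyclicChanges m v → HasCyclicChanges m w := by
  classical
  have hev : ∀ᶠ v in 𝓝 w, ∀ i, w i ≠ 0 → 0 < w i * v i := by
    rw [Filter.eventually_all]
    intro i
    by_cases hi : w i = 0
    · simp [hi]
    · have h : ContinuousAt (fun v : Fin n → ℝ => w i * v i) w :=
        (continuous_const.mul (continuous_apply i)).continuousAt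
      filter_upwards [h.eventually_const_lt (mul_self_pos.2 hi)] with v hv _ using hv
  filter_upwards [hev] with v hv h
  refine h.of_map (fun k => if w (ringIdx n k) ≠ 0 then k
    else if 0 < w (ringIdx n (k + 1)) * v (ringIdx n k) then k + 1 else k + -1) ?_ ?_ ?_
  · refine monotone_int_of_le_succ fun k => ?_
    by_cases hk : w (ringIdx n k) = 0
    · have h1 : w (ringIdx n (k + 1)) ≠ 0 := by
        intro h0; have := hw k hk; simp [h0] at this
      simp only [hk, h1, ne_eq, not_true_eq_false, not_false_eq_true, if_true, if_false]
      split_ifs <;> omega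
    · simp only [ne_eq, hk, not_false_eq_true, if_true]
      split_ifs <;> omega
  · intro k
    simp only [ringIdx_add_period, add_right_comm k (n : ℤ) 1]
    split_ifs <;> ring
  · intro k hk
    split_ifs with h1 h2
    · exact hv _ h1
    · exact h2
    · have h3 := hw k (by simpa using h1)
      by_contra! h4
      have h5 : w (ringIdx n (k + 1)) ≠ 0 := by rintro h0; simp [h0] at h3
      have h6 : w (ringIdx n (k + -1)) ≠ 0 := by rintro h0; simp [h0] at h3
      have h7 := lt_of_le_of_ne h4 (mul_ne_zero h6 hk)
      have h8 := lt_of_le_of_ne (not_lt.1 h2) (mul_ne_zero h5 hk)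
      nlinarith [mul_pos_of_neg_of_neg h7 h8,
        mul_nonneg (neg_nonneg.2 h3.le) (mul_self_nonneg (v (ringIdx n k)))]

/-- If the velocity `A w` vanishes wherever `w` does, then irreducibility forces every zero of `w`
to be isolated and to separate entries of opposite signs. -/
theorem mul_neighbours_neg {A : Matrix (Fin n) (Fin n) ℝ} (hA : A ∈ QPlus n) {w : Fin n → ℝ}
    (hw : w ≠ 0) (hAw : ∀ i, w i = 0 → (A *ᵥ w) i = 0) {k : ℤ} (hk : w (ringIdx n k) = 0) :
    w (ringIdx n (k + -1)) * w (ringIdx n (k + 1)) < 0 := by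
  obtain ⟨hM, hirr, hband⟩ := hA
  obtain ⟨p, hp⟩ := Function.ne_iff.1 hw
  have hnb : ∀ k j, A (ringIdx n k) j ≠ 0 →
      j = ringIdx n k ∨ j = ringIdx n (k + 1) ∨ j = ringIdx n (k + -1) := by
    intro k j h
    have := (hband _ _ h).eq_or
    rwa [ringIdx_add_congr (ringIdx_coe _), ringIdx_add_congr (ringIdx_coe _)] at this
  -- A zero entry that has a zero neighbour feels no nonzero entry.
  have hR : ∀ k, ¬ (w (ringIdx n k) = 0 ∧
      (w (ringIdx n (k + 1)) = 0 ∨ w (ringIdx n (k + -1)) = 0)) := by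
    intro k₀ hk₀
    refine hirr ⟨{i | ∃ k, i = ringIdx n k ∧ w (ringIdx n k) = 0 ∧
      (w (ringIdx n (k + 1)) = 0 ∨ w (ringIdx n (k + -1)) = 0)}ᶜ, ⟨p, ?_⟩,
      ⟨ringIdx n k₀, ?_⟩, ?_⟩
    · rintro ⟨k, rfl, h, -⟩
      exact hp h
    · simpa using ⟨k₀, rfl, hk₀⟩
    · intro i hi j hj
      rw [compl_compl] at hi
      obtain ⟨k, rfl, h0, h1⟩ := hi
      by_contra hne
      have hsum := hAw _ h0
      rw [Matrix.mulVec, dotProduct] at hsum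
      have hwj : w j ≠ 0 := by
        intro hwj
        rcases hnb k j hne with rfl | rfl | rfl
        · exact hj ⟨k, rfl, h0, h1⟩
        · exact hj ⟨k + 1, rfl, hwj, Or.inr (by simpa using h0)⟩
        · exact hj ⟨k + -1, rfl, hwj, Or.inl (by simpa using h0)⟩
      rw [Finset.sum_eq_single j, mul_eq_zero] at hsum
      · exact hsum.elim hne hwj
      · intro l _ hlj
        by_contra hl
        have hAl : A (ringIdx n k) l ≠ 0 := left_ne_zero_of_mul hl
        have hwl : w l ≠ 0 := right_ne_zero_of_mul hl
        rcases hnb k j hne with rfl | rfl | rfl <;> rcases hnb k l hAl with rfl | rfl | rfl <;>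
          simp_all
      · simp
  have h1 : w (ringIdx n (k + 1)) ≠ 0 := fun h => hR k ⟨hk, Or.inl h⟩
  have h2 : w (ringIdx n (k + -1)) ≠ 0 := fun h => hR k ⟨hk, Or.inr h⟩
  by_contra! hc
  have h3 : 0 < w (ringIdx n (k + -1)) * w (ringIdx n (k + 1)) :=
    lt_of_le_of_ne hc (Ne.symm (mul_ne_zero h2 h1))
  have hnonneg : ∀ l, 0 ≤ A (ringIdx n k) l * (w l * w (ringIdx n (k + 1))) := by
    intro l
    by_cases hl : A (ringIdx n k) l = 0
    · simp [hl]
    by_cases hlk : ringIdx n k = l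
    · simp [← hlk, hk]
    refine mul_nonneg (hM _ _ hlk) ?_
    rcases hnb k l hl with rfl | rfl | rfl
    · exact absurd rfl hlk
    · exact mul_self_nonneg _
    · exact hc
  have hsum : ∑ l, A (ringIdx n k) l * (w l * w (ringIdx n (k + 1))) = 0 := by
    have := hAw _ hk
    rw [Matrix.mulVec, dotProduct] at this
    rw [← zero_mul (w (ringIdx n (k + 1))), ← this, Finset.sum_mul]
    exact Finset.sum_congr rfl fun l _ => by ring
  rw [Finset.sum_eq_zero_iff_of_nonneg fun l _ => hnonneg l] at hsum
  refine hirr ⟨{ringIdx n k}ᶜ, ⟨p, ?_⟩, ⟨ringIdx n k, by simp⟩, ?_⟩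
  · rintro rfl
    exact hp hk
  · intro i hi j hj
    rw [compl_compl] at hi
    obtain rfl : i = ringIdx n k := hi
    by_contra hne
    rcases mul_eq_zero.1 (hsum j (Finset.mem_univ j)) with h | h
    · exact hne h
    rcases hnb k j hne with rfl | rfl | rfl
    · exact hj rfl
    · exact mul_ne_zero h1 h1 h
    · exact mul_ne_zero h2 h1 h

/-- The sign changes obtained by filling the zeros of `y` by `±1` occur arbitrarily close to `y`:
fill by `±δ` instead. -/
theorem exists_tendsto_hasCyclicChanges {y : Fin n → ℝ} {ε : Fin n → Bool} {m : ℕ}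
    (h : HasCyclicChanges m (fillZeros y ε)) :
    ∃ z : ℝ → Fin n → ℝ, Tendsto z (𝓝[>] 0) (𝓝 y) ∧ ∀ δ > 0, HasCyclicChanges m (z δ) := by
  refine ⟨fun δ i => if y i = 0 then δ * fillZeros y ε i else y i, ?_, ?_⟩
  · rw [tendsto_pi_nhds]
    intro i
    by_cases hi : y i = 0
    · simp only [hi, if_true]
      have : Tendsto (fun δ : ℝ => δ * fillZeros y ε i) (𝓝 0) (𝓝 (0 * fillZeros y ε i)) :=
        tendsto_id.mul_const _
      rw [zero_mul] at this
      exact this.mono_left nhdsWithin_le_nhds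
    · simpa only [hi, if_false] using tendsto_const_nhds
  · intro δ hδ
    refine h.of_map id monotone_id (fun _ => rfl) fun k hk => ?_
    have hpos := mul_self_pos.2 hk
    simp only [id]
    split_ifs with h0
    · rw [mul_assoc]; exact mul_pos hδ hpos
    · simp [fillZeros, h0]

/-- The flow of a matrix in `Q⁺` has the strong cyclic variation diminishing property. -/
theorem sCVDP_exp {A : Matrix (Fin n) (Fin n) ℝ} (hA : A ∈ QPlus n) {t : ℝ} (ht : 0 < t) :
    SCVDP (NormedSpace.exp (t • A)) := by
  intro x hx
  rcases Nat.eq_zero_or_pos (sPlusCyc (NormedSpace.exp (t • A) *ᵥ x)) with h0 | hpos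
  · omega
  obtain ⟨ε, hε⟩ := exists_hasCyclicChanges_fillZeros hpos
  generalize sPlusCyc (NormedSpace.exp (t • A) *ᵥ x) = m at *
  have hflow : ∀ s : ℝ, 0 ≤ s → ∀ v : Fin n → ℝ,
      HasCyclicChanges m (NormedSpace.exp (s • A) *ᵥ v) → HasCyclicChanges m v := by
    intro s hs v hv
    refine hv.of_exp_mulVec (fun i j hij => ?_) fun i j hij => hA.2.2 i j ?_
    · simpa using mul_nonneg hs (hA.1 i j hij)
    · rintro h; simp [h] at hij
  -- At a generic time, an entry of the solution vanishes only if it does so identically nearby.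
  obtain ⟨V, hVt, hV, ⟨τ, hτ⟩, hdich⟩ := exists_isOpen_zero_or_ne
    (f := fun i (s : ℝ) => (NormedSpace.exp (s • A) *ᵥ x) i)
    (fun i => continuous_iff_continuousAt.2
      fun s => (hasDerivAt_exp_mulVec_apply A x i s).continuousAt)
    (isOpen_Ioo (a := 0) (b := t)) (Set.nonempty_Ioo.2 ht)
  obtain ⟨hτ0, hτt⟩ := hVt hτ
  set w := NormedSpace.exp (τ • A) *ᵥ x with hwdef
  have hw : w ≠ 0 := by
    intro hw
    apply hx
    have := congrArg (fun v => NormedSpace.exp ((-τ) • A) *ᵥ v) hw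
    simpa only [hwdef, Matrix.mulVec_mulVec, exp_neg_smul_mul, Matrix.one_mulVec,
      Matrix.mulVec_zero] using this
  have hAw : ∀ i, w i = 0 → (A *ᵥ w) i = 0 := by
    intro i hi
    have hz : ∀ s ∈ V, (NormedSpace.exp (s • A) *ᵥ x) i = 0 :=
      (hdich i).resolve_right fun h => h τ hτ hi
    refine (hasDerivAt_exp_mulVec_apply A x i τ).unique ?_
    refine (hasDerivAt_const τ (0 : ℝ)).congr_of_eventuallyEq ?_
    filter_upwards [hV.mem_nhds hτ] with s hs using hz s hs
  have hloc := eventually_hasCyclicChanges_imp (fun k => mul_neighbours_neg hA hw hAw) m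
  obtain ⟨z, hz, hzm⟩ := exists_tendsto_hasCyclicChanges hε
  have hback : Tendsto (fun δ => NormedSpace.exp ((-(t - τ)) • A) *ᵥ z δ) (𝓝[>] 0) (𝓝 w) := by
    have hw' : w = NormedSpace.exp ((-(t - τ)) • A) *ᵥ (NormedSpace.exp (t • A) *ᵥ x) := by
      rw [Matrix.mulVec_mulVec, ← exp_add_smul]
      simp [hwdef]
    rw [hw']
    exact ((continuous_const.matrix_mulVec continuous_id).tendsto _).comp hz
  obtain ⟨δ, hδ, hδ0⟩ := ((hback.eventually hloc).and self_mem_nhdsWithin).exists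
  refine HasCyclicChanges.le_sMinusCyc hpos (hflow τ hτ0.le x (hδ ?_))
  refine hflow (t - τ) (by linarith) _ ?_
  rw [Matrix.mulVec_mulVec, exp_mul_neg_smul, Matrix.one_mulVec]
  exact hzm δ hδ0

end Strong

/-! ### Necessity of the conditions -/

section Necessity

variable {n : ℕ} [NeZero n]

theorem HasCyclicChanges.le_sPlusCyc_self {y : Fin n → ℝ} {m : ℕ} (hm : 0 < m)
    (h : HasCyclicChanges m y) : m ≤ sPlusCyc y := by
  refine HasCyclicChanges.le_sPlusCyc (ε := fun _ => true) hm
    (h.of_map id monotone_id (fun _ => rfl) fun k hk => ?_)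
  simp [fillZeros, hk]

/-- A column `M e_j` has no cyclic sign changes, whichever way its zeros are filled, so all its
entries have the sign of the diagonal one. -/
theorem SCVDP.apply_pos {M : Matrix (Fin n) (Fin n) ℝ} (hM : SCVDP M) {j : Fin n}
    (hj : 0 < M j j) (i : Fin n) : 0 < M i j := by
  by_contra! hi
  have hij : (i : ℕ) ≠ j := by
    intro h
    rw [Fin.ext h] at hi
    linarith
  have hy : ∀ l, (M *ᵥ Pi.single j 1) l = M l j := by simp
  have h1 : 1 ≤ sPlusCyc (M *ᵥ Pi.single j 1) := by
    refine HasCyclicChanges.le_sPlusCyc (ε := fun _ => false) one_pos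
      ⟨fun l => if l = 0 then (i : ℕ) else if (i : ℕ) < j then (j : ℕ) else (j : ℕ) + n, ?_, ?_, ?_⟩
    · intro l hl
      obtain rfl : l = 0 := by omega
      simp only [zero_add, one_ne_zero, if_true, if_false]
      split_ifs <;> omega
    · simp only [one_ne_zero, if_true, if_false]
      split_ifs <;> omega
    · intro l hl
      obtain rfl : l = 0 := by omega
      have h2 : ringIdx n (if (i : ℕ) < j then ((j : ℕ) : ℤ) else (j : ℕ) + n) = j := by
        split_ifs <;> simp
      simp only [zero_add, one_ne_zero, if_true, if_false, h2, ringIdx_coe]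
      refine mul_neg_of_neg_of_pos ?_ ?_
      · unfold fillZeros
        rw [hy]
        split_ifs with h0
        · contradiction
        · norm_num
        · exact lt_of_le_of_ne hi h0
      · simpa [fillZeros, hj.ne'] using hj
  have h2 := h1.trans (hM (Pi.single j 1) (by simp))
  obtain ⟨k, -, -, hk⟩ := hasCyclicChanges_sMinusCyc (x := Pi.single j 1) h2
  have h3 := hk 0 h2
  have hnn : ∀ l, (0 : ℝ) ≤ (Pi.single j 1 : Fin n → ℝ) l := by
    intro l
    have : (0 : Fin n → ℝ) ≤ Pi.single j 1 := Pi.single_nonneg.2 zero_le_one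
    exact this l
  exact absurd h3 (not_lt.2 (mul_nonneg (hnn _) (hnn _)))

theorem ringIdx_ne {k l : ℤ} (h1 : k < l) (h2 : l < k + n) : ringIdx n k ≠ ringIdx n l := by
  intro h
  rw [ringIdx_eq_iff] at h
  have h3 : (n : ℤ) ∣ l - k := Int.ModEq.dvd h
  have := Int.le_of_dvd (by omega) h3
  omega

/-- A vector with a single positive entry has at most two cyclic sign changes. -/
theorem sMinusCyc_lt_three {x : Fin n → ℝ} {j : Fin n} (hx : ∀ l, 0 < x l → l = j) :
    sMinusCyc x < 3 := by
  by_contra! h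
  obtain ⟨p, h1, h2, h3⟩ := hasCyclicChanges_sMinusCyc (x := x) (by omega)
  generalize sMinusCyc x = m at *
  have hlast : p 3 ≤ p 0 + n := by
    rcases h.eq_or_lt with rfl | h
    · exact h2
    · exact (strictMono_steps h1 h le_rfl).le.trans h2
  have p1 := h1 0 (by omega)
  have p2 := h1 1 (by omega)
  have p3 := h1 2 (by omega)
  have q1 := h3 0 (by omega)
  have q2 := h3 1 (by omega)
  have q3 := h3 2 (by omega)
  simp only [zero_add, Nat.reduceAdd] at p1 p2 p3 q1 q2 q3
  rcases mul_neg_iff.1 q1 with ⟨a, b⟩ | ⟨a, b⟩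
  · have c := pos_of_mul_neg_right q2 b.le
    exact ringIdx_ne (by omega) (by omega) ((hx _ a).trans (hx _ c).symm)
  · have c := neg_of_mul_neg_right q2 b.le
    have d := pos_of_mul_neg_right q3 c.le
    exact ringIdx_ne (by omega) (by omega) ((hx _ b).trans (hx _ d).symm)

/-- A vector with two positive entries in positions outside the cyclic band, all other entries
being negative, has at least three cyclic sign changes (hence four). -/
theorem hasCyclicChanges_three {y : Fin n → ℝ} {i j : Fin n} (hij : ¬ InCyclicBand i j)
    (hi : 0 < y i) (hj : 0 < y j) (hy : ∀ l, l ≠ i → l ≠ j → y l < 0) :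
    HasCyclicChanges 3 y := by
  obtain ⟨q, hq, h1, h2⟩ : ∃ q : ℤ, ringIdx n q = j ∧ (i : ℕ) + 1 < q ∧ q + 1 < (i : ℕ) + n := by
    unfold InCyclicBand at hij
    rw [Fin.ext_iff] at hij
    rcases lt_or_ge (i : ℕ) j with h | h
    · exact ⟨(j : ℕ), by simp, by omega, by omega⟩
    · exact ⟨(j : ℕ) + n, by simp, by omega, by omega⟩
  have hi' := ringIdx_coe i
  have y1 : y (ringIdx n ((i : ℕ) + 1)) < 0 := by
    refine hy _ ?_ ?_
    · rw [← hi']; simpa using (ringIdx_ne (n := n) (k := (i : ℕ)) (by omega) (by omega)).symm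
    · rw [← hq]; exact ringIdx_ne (by omega) (by omega)
  have y3 : y (ringIdx n (q + 1)) < 0 := by
    refine hy _ ?_ ?_
    · rw [← hi']; simpa using (ringIdx_ne (n := n) (k := (i : ℕ)) (l := q + 1)
        (by omega) (by omega)).symm
    · rw [← hq]; exact (ringIdx_ne (by omega) (by omega)).symm
  refine ⟨fun l => if l = 0 then (i : ℕ) else if l = 1 then (i : ℕ) + 1 else if l = 2 then q
    else q + 1, ?_, ?_, ?_⟩
  · intro l hl
    interval_cases l <;> (simp; try omega)
  · simp; omega
  · intro l hl
    interval_cases l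
    · simpa using mul_neg_of_pos_of_neg hi y1
    · simpa [hq] using mul_neg_of_neg_of_pos y1 hj
    · simpa [hq] using mul_neg_of_pos_of_neg hj y3

theorem eventually_pos_of_hasDerivAt {f : ℝ → ℝ} {c t : ℝ} (hf : HasDerivAt f c t) (h0 : f t = 0)
    (hc : 0 < c) : ∀ᶠ s in 𝓝[>] t, 0 < f s := by
  have h1 := (hasDerivAt_iff_tendsto_slope.1 hf).mono_left
    (nhdsWithin_mono t (show Set.Ioi t ⊆ {t}ᶜ from fun s hs => ne_of_gt hs))
  filter_upwards [h1.eventually_const_lt hc, self_mem_nhdsWithin] with s hs hst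
  rw [slope_def_field, h0, sub_zero] at hs
  have hst' : 0 < s - t := sub_pos.2 hst
  exact (div_pos_iff_of_pos_right hst').1 hs

theorem nonneg_of_hasDerivAt {f : ℝ → ℝ} {c t : ℝ} (hf : HasDerivAt f c t) (h0 : f t = 0)
    (hpos : ∀ᶠ s in 𝓝[>] t, 0 ≤ f s) : 0 ≤ c := by
  by_contra! hc
  have h1 := eventually_pos_of_hasDerivAt hf.neg (by simp [h0]) (neg_pos.2 hc)
  obtain ⟨s, h2, h3⟩ := (h1.and hpos).exists
  simp only [Pi.neg_apply] at h2
  linarith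

/-- A coupling between non-neighbours lets the entry at `i` grow out of zero under the influence of
the entry at `j`, with both arcs between them negative: two sign changes become four. -/
theorem inCyclicBand_of_sCVDP {B : ℝ → Matrix (Fin n) (Fin n) ℝ} {A : Matrix (Fin n) (Fin n) ℝ}
    {t : ℝ} (h0 : B t = 1) (hB : HasDerivAt B A t) (hcv : ∀ᶠ s in 𝓝[>] t, SCVDP (B s))
    {i j : Fin n} (hA : 0 < A i j) : InCyclicBand i j := by
  classical
  by_contra hij
  have hne : i ≠ j := fun h => hij (Or.inl h)
  set x : ℝ → Fin n → ℝ := fun δ l => if l = j then 1 else if l = i then 0 else -δ with hx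
  have hpos : ∀ᶠ δ in 𝓝[>] (0 : ℝ), 0 < (A *ᵥ x δ) i := by
    have hc : Continuous fun δ => (A *ᵥ x δ) i := by
      have hxc : Continuous x := by
        refine continuous_pi fun l => ?_
        simp only [hx]
        split_ifs <;> fun_prop
      exact (continuous_apply i).comp (continuous_const.matrix_mulVec hxc)
    have hx0 : x 0 = Pi.single j 1 := by
      ext l
      by_cases hl : l = j
      · subst hl; simp [hx]
      · simp [hx, hl]
    refine (hc.continuousAt.eventually_const_lt ?_).filter_mono nhdsWithin_le_nhds
    simpa only [hx0, Matrix.mulVec_single_one, Matrix.col_apply] using hA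
  obtain ⟨δ, hδ, hδ0⟩ := (hpos.and self_mem_nhdsWithin).exists
  have hδ0 : 0 < δ := hδ0
  have hval : ∀ l, (B t *ᵥ x δ) l = x δ l := by simp [h0]
  have hd := hasDerivAt_mulVec_apply hB (x δ)
  have e1 : ∀ᶠ s in 𝓝[>] t, 0 < (B s *ᵥ x δ) i :=
    eventually_pos_of_hasDerivAt (hd i) (by rw [hval]; simp [hx, hne]) hδ
  have e2 : ∀ᶠ s in 𝓝[>] t, 0 < (B s *ᵥ x δ) j :=
    ((hd j).continuousAt.eventually_const_lt (by simp only [hval]; simp [hx])).filter_mono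
      nhdsWithin_le_nhds
  have e3 : ∀ᶠ s in 𝓝[>] t, ∀ l, l ≠ i → l ≠ j → (B s *ᵥ x δ) l < 0 := by
    rw [Filter.eventually_all]
    intro l
    by_cases h : l = i ∨ l = j
    · exact Eventually.of_forall fun s h1 h2 => (h.elim h1 h2).elim
    · push Not at h
      have : ∀ᶠ s in 𝓝 t, (B s *ᵥ x δ) l < 0 :=
        (hd l).continuousAt.eventually_lt_const (by
          simp only [hval]; simpa [hx, h.1, h.2] using hδ0)
      filter_upwards [this.filter_mono nhdsWithin_le_nhds] with s hs _ _ using hs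
  obtain ⟨s, hs1, hs2, hs3, hs4⟩ := (e1.and (e2.and (e3.and hcv))).exists
  have h3 := (hasCyclicChanges_three hij hs1 hs2 hs3).le_sPlusCyc_self (by norm_num)
  have hx0 : x δ ≠ 0 := by
    intro h; have := congrFun h j; simp [hx] at this
  have h4 := sMinusCyc_lt_three (x := x δ) (j := j) (by
    intro l hl
    by_contra hlj
    simp only [hx, hlj, if_false] at hl
    split_ifs at hl <;> linarith)
  have := hs4 _ hx0
  omega

/-- The exponential of a reducible matrix keeps its zero block, since the powers of `1 + A / k` do. -/
theorem exp_apply_eq_zero {A : Matrix (Fin n) (Fin n) ℝ} {S : Set (Fin n)}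
    (hS : ∀ i ∈ Sᶜ, ∀ j ∈ S, A i j = 0) {i j : Fin n} (hi : i ∈ Sᶜ) (hj : j ∈ S) :
    NormedSpace.exp A i j = 0 := by
  have hF : HasDerivAt (fun s : ℝ => 1 + s • A) A 0 := by
    have := ((hasDerivAt_id (0 : ℝ)).smul_const A).const_add (1 : Matrix (Fin n) (Fin n) ℝ)
    rwa [one_smul] at this
  have hlim := tendsto_pow_exp (F := fun s : ℝ => 1 + s • A) (by simp) hF
  have hlim' : Tendsto (fun k : ℕ => ((1 + (k : ℝ)⁻¹ • A) ^ k) i j) atTop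
      (𝓝 (NormedSpace.exp A i j)) :=
    ((continuous_id.matrix_elem i j).tendsto _).comp hlim
  refine tendsto_nhds_unique hlim' (tendsto_const_nhds.congr fun k => ?_)
  have hpow : ∀ P : Matrix (Fin n) (Fin n) ℝ, (∀ i ∈ Sᶜ, ∀ j ∈ S, P i j = 0) →
      ∀ q : ℕ, ∀ i ∈ Sᶜ, ∀ j ∈ S, (P ^ q) i j = 0 := by
    intro P hP q
    induction q with
    | zero =>
      intro i hi j hj
      rw [pow_zero, Matrix.one_apply_ne]
      rintro rfl
      exact hi hj
    | succ q ih =>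
      intro i hi j hj
      rw [pow_succ, Matrix.mul_apply]
      refine Finset.sum_eq_zero fun l _ => ?_
      by_cases hl : l ∈ S
      · rw [ih i hi l hl, zero_mul]
      · rw [hP l hl j hj, mul_zero]
  refine (hpow _ (fun i hi j hj => ?_) k i hi j hj).symm
  have hij : i ≠ j := by rintro rfl; exact hi hj
  simp [hS i hi j hj, Matrix.one_apply_ne hij]

/-- It is enough to know the variation diminishing property for one initial time and for short
times after it. -/
theorem mem_qPlus_of_sCVDP {B : ℝ → Matrix (Fin n) (Fin n) ℝ} {A : Matrix (Fin n) (Fin n) ℝ}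
    {t u : ℝ} (htu : t < u) (h0 : B t = 1) (hB : ∀ s ∈ Set.Icc t u, HasDerivAt B (A * B s) s)
    (hcv : ∀ s ∈ Set.Ioc t u, SCVDP (B s)) : A ∈ QPlus n := by
  have hd : HasDerivAt B A t := by simpa [h0] using hB t ⟨le_rfl, htu.le⟩
  have hIoc : ∀ᶠ s in 𝓝[>] t, s ∈ Set.Ioc t u := Ioc_mem_nhdsGT htu
  have hent : ∀ i j, HasDerivAt (fun s => B s i j) (A i j) t := by
    intro i j
    simpa using hasDerivAt_mulVec_apply hd (Pi.single j 1) i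
  have hpos : ∀ j, ∀ᶠ s in 𝓝[>] t, ∀ i, 0 < B s i j := by
    intro j
    have h1 : ∀ᶠ s in 𝓝 t, 0 < B s j j :=
      (hent j j).continuousAt.eventually_const_lt (by simp [h0])
    filter_upwards [h1.filter_mono nhdsWithin_le_nhds, hIoc] with s hs hsu
    exact (hcv s hsu).apply_pos hs
  have hM : IsMetzler A := fun i j hij =>
    nonneg_of_hasDerivAt (hent i j) (by simp [h0, hij]) ((hpos j).mono fun s hs => (hs i).le)
  refine ⟨hM, ?_, fun i j hij => ?_⟩
  · rintro ⟨S, ⟨j, hj⟩, ⟨i, hi⟩, hS⟩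
    obtain ⟨s, hs, hsu⟩ := ((hpos j).and hIoc).exists
    have h1 := hs i
    rw [eq_exp_of_hasDerivAt hsu.1.le h0 fun r hr => hB r ⟨hr.1, hr.2.trans hsu.2⟩] at h1
    rw [exp_apply_eq_zero (fun i hi j hj => by simp [hS i hi j hj]) hi hj] at h1
    exact lt_irrefl _ h1
  · by_cases h : i = j
    · exact Or.inl h
    · exact inCyclicBand_of_sCVDP h0 hd (hIoc.mono fun s hs => hcv s hs)
        (lt_of_le_of_ne (hM i j h) (Ne.symm hij))

end Necessity

/-! ### The characterization -/

theorem isTransitionMatrix_exp {n : ℕ} (A : Matrix (Fin n) (Fin n) ℝ) (a b : EReal) :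
    IsTransitionMatrix (fun _ : ℝ => A) a b fun t s => NormedSpace.exp ((t - s) • A) where
  init := fun t₀ _ _ => by simp
  deriv := fun t₀ t _ _ _ _ => by
    have h1 := hasDerivAt_exp_smul_const' (𝕂 := ℝ) A (t - t₀)
    have h2 : HasDerivAt (fun s : ℝ => s - t₀) 1 t := (hasDerivAt_id t).sub_const t₀
    have h3 := h1.scomp t h2
    rw [one_smul] at h3
    exact h3

end CyclicVDP

theorem theorem4 (n : ℕ) (a b : EReal) (hab : a < b) (A : Matrix (Fin n) (Fin n) ℝ) :
    CyclicVDP.IsCVDDS (fun _ : ℝ => A) a b ↔ A ∈ CyclicVDP.QPlus n := by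
  rcases Nat.eq_zero_or_pos n with rfl | hn
  · -- On the empty ring both properties hold vacuously.
    refine ⟨fun _ => ⟨fun i => i.elim0, ?_, fun i => i.elim0⟩, fun _ =>
      ⟨_, CyclicVDP.isTransitionMatrix_exp A a b,
        fun _ _ _ _ _ x hx => absurd (Subsingleton.elim x 0) hx⟩⟩
    rintro ⟨S, ⟨i, -⟩, -⟩
    exact i.elim0
  have : NeZero n := ⟨hn.ne'⟩
  constructor
  · rintro ⟨Φ, hΦ, hcv⟩
    obtain ⟨t, hat, htb⟩ := EReal.lt_iff_exists_real_btwn.1 hab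
    obtain ⟨u, htu, hub⟩ := EReal.lt_iff_exists_real_btwn.1 htb
    have htu' : t < u := by exact_mod_cast htu
    refine CyclicVDP.mem_qPlus_of_sCVDP (B := fun s => Φ s t) htu' (hΦ.init t hat htb) ?_ ?_
    · intro s hs
      exact hΦ.deriv t s hat htb (hat.trans_le (by exact_mod_cast hs.1))
        (lt_of_le_of_lt (by exact_mod_cast hs.2) hub)
    · intro s hs
      exact hcv t s hat hs.1 (lt_of_le_of_lt (by exact_mod_cast hs.2) hub)
  · intro hA
    exact ⟨_, CyclicVDP.isTransitionMatrix_exp A a b, fun t₀ t _ h _ =>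
      CyclicVDP.sCVDP_exp hA (sub_pos.2 h)⟩
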